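/- Setting. Let $X$ be a countable set with $m:X\to(0,\infty)$, and let $\mu:X\times X\to[0,\infty)$, $(x,y)\mapsto\mu_{xy}$, be symmetric with $\mu_{xx}=0$ and $\sum_{y\in X}\mu_{xy}<\infty$ for all $x\in X$; write $x\sim y$ if $\mu_{xy}>0$. The weighted graph $(X,\mu,m)$ is connected if any two vertices are joined by a finite path $x=x_0\sim x_1\sim\dots\sim x_n=y$. Put $\mathrm{Deg}(x)=\frac1{m(x)}\sum_{y}\mu_{xy}$. A pseudo metric $\rho:X\times X\to[0,\infty)$ is intrinsic if $\sum_{y}\mu_{xy}\rho(x,y)^2\le m(x)$ for all $x\in X$, and compatible if $\sup_{x\sim y}\rho(x,y)<\infty$ and $\mathrm{Deg}$ is bounded on every ball $\{x\in X:\rho(x,o)\le r\}$, $o\in X$, $r\ge0$. For a fixed base point $o\in X$ let $\rho_1=1\vee\rho(\cdot,o)$, and let $m\rho_1^{-2}$ be the measure on $X$ with weight $m(x)\rho_1(x)^{-2}$ at $x$. A Hadamard space is a complete geodesic metric space $(Y,d)$ such that for all $p,q,r\in Y$ and every geodesic $\gamma:[0,1]\to Y$ from $q$ to $r$ (parametrized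 proportionally to arc length), with $p',q',r'$ a triangle in the Euclidean plane having the same side lengths as $p,q,r$, one has $d(p,\gamma(t))\le|p'-((1-t)q'+tr')|$ for all $t\in[0,1]$. The barycenter $b(\nu)$ of a Borel probability measure $\nu$ on $Y$ with separable support and finite first moment is the unique minimizer of $z\mapsto\int_Y\big(d(z,w)^2-d(y_0,w)^2\big)\,\nu(dw)$, which does not depend on $y_0\in Y$. Let $P_x$ be the measure on $X$ with $P_x(y)=\mu_{xy}/\sum_{z}\mu_{xz}$ (with the convention $P_x=0$, for which every point counts as a barycenter, if $X=\{x\}$). A map $u:X\to Y$ is harmonic if $\sum_{z\in X}d(u(z),y_0)P_x(z)<\infty$ for all $x\in X$, $y_0\in Y$, and $u(x)=b(u_*P_x)$ for every $x\in X$, where $u_*P_x$ is the push-forward of $P_x$ under $u$. Theorem 1.8 (Karp's theorem for harmonic maps). Let $(X,\mu,m)$ be a connected weighted graph with a compatible intrinsic metric $\rho$, let $o\in X$, and let $u:X\to Y$ be a harmonic map into a Hadamard space $(Y,d)$. Suppose that there are $p\in(1,\infty)$ and $y\in Y$ with $$d(u(\cdot),y)\in L^p(X,m\rho_1^{-2}).$$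 Then $u$ is bounded. If, moreover, $m\rho_1^{-2}(X)=\infty$ or $y$ is in the image of $u$, then $u$ is constant. -/

import Mathlib

open MeasureTheory
open scoped ENNReal

noncomputable section

/-- A weighted graph `(X, μ, m)`: a vertex measure `m : X → (0, ∞)` and a symmetric edge weight
`μ : X × X → [0, ∞)` that vanishes on the diagonal and is summable at every vertex. Local
finiteness is not required. -/
structure WeightedGraph (X : Type*) where
  μ : X → X → ℝ
  m : X → ℝ
  m_pos : ∀ x, 0 < m x
  μ_nonneg : ∀ x y, 0 ≤ μ x y
  μ_symm : ∀ x y, μ x y = μ y x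
  μ_diag : ∀ x, μ x x = 0
  μ_summable : ∀ x, Summable (μ x)

namespace WeightedGraph

variable {X : Type*}

/-- `x ∼ y`: the vertices are joined by an edge. -/
def Adj (G : WeightedGraph X) (x y : X) : Prop := 0 < G.μ x y

/-- Any two vertices are joined by a finite path `x = x₀ ∼ x₁ ∼ ⋯ ∼ xₙ = y`. -/
def Connected (G : WeightedGraph X) : Prop := ∀ x y, Relation.ReflTransGen G.Adj x y

/-- The total edge weight `∑_y μ_xy` at a vertex. -/
def totalWeight (G : WeightedGraph X) (x : X) : ℝ := ∑' y, G.μ x y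

/-- The weighted vertex degree `Deg x = (1 / m x) ∑_y μ_xy`. -/
def Deg (G : WeightedGraph X) (x : X) : ℝ := G.totalWeight x / G.m x

/-- The jump size `sup {ρ x y | x ∼ y}`, with values in `[0, ∞]`. -/
def jumpSize (G : WeightedGraph X) (ρ : X → X → ℝ) : ℝ≥0∞ :=
  ⨆ (x : X) (y : X) (_ : G.Adj x y), ENNReal.ofReal (ρ x y)

end WeightedGraph

/-- A pseudo metric: symmetric, `[0, ∞)`-valued, zero on the diagonal, with the triangle
inequality; distinct points may have distance zero. -/
structure IsPseudoMetric {X : Type*} (ρ : X → X → ℝ) : Prop where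
  nonneg : ∀ x y, 0 ≤ ρ x y
  symm : ∀ x y, ρ x y = ρ y x
  diag : ∀ x, ρ x x = 0
  triangle : ∀ x y z, ρ x z ≤ ρ x y + ρ y z

namespace WeightedGraph

variable {X : Type*}

/-- An intrinsic metric: a pseudo metric with `∑_y μ_xy ρ(x, y)² ≤ m x` for all `x`. -/
structure IsIntrinsic (G : WeightedGraph X) (ρ : X → X → ℝ) : Prop where
  isPseudoMetric : IsPseudoMetric ρ
  summable : ∀ x, Summable fun y => G.μ x y * ρ x y ^ 2
  tsum_le : ∀ x, ∑' y, G.μ x y * ρ x y ^ 2 ≤ G.m x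

/-- Finite jump size, and `Deg` is bounded on every distance ball. -/
structure IsCompatible (G : WeightedGraph X) (ρ : X → X → ℝ) : Prop where
  jumpSize_lt_top : G.jumpSize ρ < ∞
  deg_bounded : ∀ (o : X) (r : ℝ), 0 ≤ r → ∃ C : ℝ, ∀ x, ρ x o ≤ r → G.Deg x ≤ C

/-- The transition probability `P_x(y) = μ_xy / ∑_z μ_xz` of the random walk. -/
def walkProb (G : WeightedGraph X) (x y : X) : ℝ := G.μ x y / G.totalWeight x

end WeightedGraph

/-- The measure on `X` with weight `w x` at each point `x`. -/
def pointMassMeasure {X : Type*} [MeasurableSpace X] (w : X → ℝ) : Measure X :=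
  Measure.sum fun x => ENNReal.ofReal (w x) • Measure.dirac x

/-- The function `ρ₁ = 1 ∨ ρ(·, o)`. -/
def rhoOne {X : Type*} (ρ : X → X → ℝ) (o x : X) : ℝ := max 1 (ρ x o)

/-- The random walk measure `P_x` as a measure on the vertices. -/
def WeightedGraph.walkMeasure {X : Type*} [MeasurableSpace X] (G : WeightedGraph X) (x : X) :
    Measure X :=
  pointMassMeasure (G.walkProb x)

/-- `γ`, restricted to `[0, 1]`, is a geodesic from `x` to `y` (minimizing, and parametrized
proportionally to arc length). -/
def IsGeodesicFromTo {Y : Type*} [MetricSpace Y] (γ : ℝ → Y) (x y : Y) : Prop :=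
  γ 0 = x ∧ γ 1 = y ∧
    ∀ s ∈ Set.Icc (0 : ℝ) 1, ∀ t ∈ Set.Icc (0 : ℝ) 1, dist (γ s) (γ t) = |s - t| * dist x y

/-- A Hadamard space (complete `CAT(0)` space): a complete geodesic metric space in which every
geodesic triangle is at least as thin as its comparison triangle `p', q', r'` in the Euclidean
plane (the triangle with the same side lengths, which is unique up to isometry): the distance
from a vertex `p` to a point of the opposite side `γ` from `q` to `r` is at most the distance
of the corresponding points of the comparison triangle. -/
structure IsHadamardSpace (Y : Type*) [MetricSpace Y] : Prop where
  complete : CompleteSpace Y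
  geodesic : ∀ x y : Y, ∃ γ : ℝ → Y, IsGeodesicFromTo γ x y
  comparison : ∀ (p q r : Y) (γ : ℝ → Y), IsGeodesicFromTo γ q r →
    ∃ p' q' r' : EuclideanSpace ℝ (Fin 2),
      dist p' q' = dist p q ∧ dist p' r' = dist p r ∧ dist q' r' = dist q r ∧
      ∀ t ∈ Set.Icc (0 : ℝ) 1, dist p (γ t) ≤ dist p' (AffineMap.lineMap q' r' t)

/-- `b` is the barycenter of `ν` (a probability measure with finite first moment): it minimizes
`z ↦ ∫ (d(z, w)² - d(y, w)²) dν(w)`. The reference point `y` makes the integrand integrable under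
a first moment only; it does not influence the minimizer, which exists and is unique in a Hadamard
space. -/
def IsBarycenter {Y : Type*} [MetricSpace Y] [MeasurableSpace Y] (ν : Measure Y) (b : Y) : Prop :=
  ∀ y z : Y, ∫ w, (dist b w ^ 2 - dist y w ^ 2) ∂ν ≤ ∫ w, (dist z w ^ 2 - dist y w ^ 2) ∂ν

/-- A harmonic map `u : X → Y`: it belongs to the class `F(X, Y)` of maps for which
`∑_z d(u(z), y₀) P_x(z) < ∞` for all `x` and `y₀`, and `u x` is the barycenter of the push-forward
`u_* P_x` for every vertex `x`. -/
structure WeightedGraph.IsHarmonicMap {X : Type*} [MeasurableSpace X] (G : WeightedGraph X)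
    {Y : Type*} [MetricSpace Y] [MeasurableSpace Y] (u : X → Y) : Prop where
  summable : ∀ (x : X) (y₀ : Y), Summable fun z => dist (u z) y₀ * G.walkProb x z
  isBarycenter : ∀ x : X, IsBarycenter ((G.walkMeasure x).map u) (u x)

end

/-!
The proof reduces to a Liouville theorem for the function `f = d(u(·), y)`.

The function `f` is subharmonic (`WeightedGraph.IsHarmonicMap.isSubharmonic_dist`): comparing the
barycenter `b` of a measure with nearby points on the geodesic towards `y`, the `CAT(0)` inequality
gives `d(b, y)² ≤ ∫ (d(y, w)² - d(b, w)²)`, and the triangle inequality turns this into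
`d(b, y) ≤ ∫ d(y, w)` (`dist_le_tsum_of_minimizer`).

A nonnegative subharmonic function `f` in `L^p(m ρ₁⁻²)` is constant
(`WeightedGraph.IsSubharmonic.eq_of_summable`). Testing subharmonicity against `η² f ^ (p - 1)` for
a cutoff `η` yields a Caccioppoli inequality (`WeightedGraph.IsSubharmonic.caccioppoli`), which
bounds `∑ μ_xy η² (f y - f x) (f y ^ (p - 1) - f x ^ (p - 1))` by a multiple of
`∑_x f x ^ p ∑_y μ_xy (η y - η x)²`. For the cutoff between the balls of radii `r` and `2 r`, the
inner sum is at most `m x / r²`, because `ρ` is intrinsic, and it vanishes unless `ρ₁ x ≤ 3 r`,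
because the jump size is finite. So the terms are dominated by `9 f ^ p m ρ₁⁻²`, and the bound tends
to zero as `r → ∞`. The degree bound on balls makes the double sums converge absolutely.

Hence `u` takes values in a sphere around `y`; its radius is zero if `y` is a value of `u` or if
nonzero constants are not in `L^p(m ρ₁⁻²)`.
-/

open Filter Topology

/-! ### Sums against point masses -/

section PointMass

variable {X : Type*} [MeasurableSpace X] [DiscreteMeasurableSpace X]

lemma lintegral_pointMassMeasure (w : X → ℝ) (h : X → ℝ≥0∞) :
    ∫⁻ x, h x ∂pointMassMeasure w = ∑' x, ENNReal.ofReal (w x) * h x := by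
  simp [pointMassMeasure, lintegral_sum_measure, lintegral_smul_measure]

lemma integrable_pointMassMeasure {w : X → ℝ} (hw : ∀ x, 0 ≤ w x) {h : X → ℝ}
    (hm : AEStronglyMeasurable h (pointMassMeasure w)) (hs : Summable fun x => w x * |h x|) :
    Integrable h (pointMassMeasure w) := by
  refine ⟨hm, ?_⟩
  rw [HasFiniteIntegral, lintegral_pointMassMeasure]
  have : (fun x => ENNReal.ofReal (w x) * ‖h x‖ₑ) = fun x => ENNReal.ofReal (w x * |h x|) := by
    ext x
    rw [ENNReal.ofReal_mul (hw x), Real.enorm_eq_ofReal_abs]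
  rw [this]
  exact hs.tsum_ofReal_lt_top

lemma integral_pointMassMeasure {w : X → ℝ} (hw : ∀ x, 0 ≤ w x) {h : X → ℝ}
    (hi : Integrable h (pointMassMeasure w)) :
    ∫ x, h x ∂pointMassMeasure w = ∑' x, w x * h x := by
  rw [pointMassMeasure] at hi ⊢
  rw [integral_sum_measure hi]
  simp [integral_smul_measure, ENNReal.toReal_ofReal, hw]

lemma summable_rpow_of_memLp_pointMassMeasure {w : X → ℝ} (hw : ∀ x, 0 ≤ w x) {f : X → ℝ}
    (hf : ∀ x, 0 ≤ f x) {p : ℝ≥0∞} (hp0 : p ≠ 0) (hp : p ≠ ∞)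
    (h : MemLp f p (pointMassMeasure w)) : Summable fun x => w x * f x ^ p.toReal := by
  have h1 := lintegral_rpow_enorm_lt_top_of_eLpNorm_lt_top hp0 hp h.2
  rw [lintegral_pointMassMeasure] at h1
  have h2 := ENNReal.summable_toReal h1.ne
  refine h2.congr fun x => ?_
  rw [Real.enorm_eq_ofReal_abs, abs_of_nonneg (hf x), ENNReal.toReal_mul,
    ENNReal.toReal_ofReal (hw x), ← ENNReal.toReal_rpow, ENNReal.toReal_ofReal (hf x)]

end PointMass

/-! ### Distance functions of harmonic maps are subharmonic -/

/-- A subharmonic function: `f x` is at most the average of `f` over the neighbours of `x`. The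
inequality is multiplied by the total weight, so it also makes sense at isolated vertices. -/
structure WeightedGraph.IsSubharmonic {X : Type*} (G : WeightedGraph X) (f : X → ℝ) : Prop where
  summable : ∀ x, Summable fun y => G.μ x y * f y
  le_tsum : ∀ x, G.totalWeight x * f x ≤ ∑' y, G.μ x y * f y

/-- The quadratic form of the `CAT(0)` inequality. -/
lemma IsHadamardSpace.dist_sq_le {Y : Type*} [MetricSpace Y] (hY : IsHadamardSpace Y)
    {q r : Y} {γ : ℝ → Y} (hγ : IsGeodesicFromTo γ q r) (w : Y) {t : ℝ}
    (ht : t ∈ Set.Icc (0 : ℝ) 1) :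
    dist w (γ t) ^ 2 ≤
      (1 - t) * dist w q ^ 2 + t * dist w r ^ 2 - t * (1 - t) * dist q r ^ 2 := by
  obtain ⟨w', q', r', h1, h2, h3, h⟩ := hY.comparison w q r γ hγ
  have key : dist w' (AffineMap.lineMap q' r' t) ^ 2 =
      (1 - t) * dist w' q' ^ 2 + t * dist w' r' ^ 2 - t * (1 - t) * dist q' r' ^ 2 := by
    have e1 : w' - AffineMap.lineMap q' r' t = (1 - t) • (w' - q') + t • (w' - r') := by
      rw [AffineMap.lineMap_apply_module]; module
    have e2 : q' - r' = (w' - r') - (w' - q') := by abel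
    simp only [dist_eq_norm]
    rw [e1, e2, norm_add_sq_real, norm_sub_sq_real (w' - r'), norm_smul, norm_smul, inner_smul_left,
      inner_smul_right, mul_pow, mul_pow, real_inner_comm (w' - q') (w' - r')]
    simp only [Real.norm_eq_abs, sq_abs, conj_trivial]
    ring
  rw [← h1, ← h2, ← h3, ← key]
  gcongr
  exact h t ht

/-- Jensen's inequality for the distance to a point. With `D = d(b, y)`, minimality of `b` along
the geodesic towards `y` and the `CAT(0)` inequality give `D² ≤ ∑ P (d(y, w)² - d(b, w)²)`, and
each summand is at most `2 D d(y, w) - D²` by the triangle inequality. -/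
lemma dist_le_tsum_of_minimizer {X Y : Type*} [MetricSpace Y] (hY : IsHadamardSpace Y)
    {P : X → ℝ} (hP : ∀ z, 0 ≤ P z) (hP1 : HasSum P 1) {v : X → Y} {b y : Y}
    (hs : ∀ y₀, Summable fun z => P z * dist (v z) y₀)
    (hb : ∀ c, Summable (fun z => P z * (dist c (v z) ^ 2 - dist b (v z) ^ 2)) →
      0 ≤ ∑' z, P z * (dist c (v z) ^ 2 - dist b (v z) ^ 2)) :
    dist b y ≤ ∑' z, P z * dist (v z) y := by
  obtain ⟨γ, hγ⟩ := hY.geodesic b y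
  have hsq (c : Y) : Summable fun z => P z * (dist c (v z) ^ 2 - dist b (v z) ^ 2) := by
    refine Summable.of_norm_bounded (((hs c).add (hs b)).mul_left (dist c b)) fun z => ?_
    rw [Real.norm_eq_abs, abs_mul, abs_of_nonneg (hP z), sq_sub_sq, abs_mul,
      abs_of_nonneg (by positivity : 0 ≤ dist c (v z) + dist b (v z))]
    have := abs_dist_sub_le c b (v z)
    calc P z * ((dist c (v z) + dist b (v z)) * |dist c (v z) - dist b (v z)|)
        ≤ P z * ((dist c (v z) + dist b (v z)) * dist c b) := by
          gcongr
          exact hP z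
      _ = _ := by rw [dist_comm (v z) c, dist_comm (v z) b]; ring
  set D := dist b y
  set V := ∑' z, P z * (dist y (v z) ^ 2 - dist b (v z) ^ 2)
  have hV (t : ℝ) (ht0 : 0 < t) (ht1 : t ≤ 1) : (1 - t) * D ^ 2 ≤ V := by
    have h0 := hb (γ t) (hsq _)
    have h1 : ∑' z, P z * (dist (γ t) (v z) ^ 2 - dist b (v z) ^ 2) ≤
        t * V - t * (1 - t) * D ^ 2 := by
      have hh : HasSum (fun z => t * (P z * (dist y (v z) ^ 2 - dist b (v z) ^ 2)) -
          t * (1 - t) * D ^ 2 * P z) (t * V - t * (1 - t) * D ^ 2 * 1) :=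
        ((hsq y).hasSum.mul_left t).sub (hP1.mul_left _)
      rw [mul_one] at hh
      rw [← hh.tsum_eq]
      refine (hsq _).tsum_le_tsum (fun z => ?_) hh.summable
      have := hY.dist_sq_le hγ (v z) ⟨ht0.le, ht1⟩
      rw [dist_comm (v z), dist_comm (v z), dist_comm (v z)] at this
      have := mul_le_mul_of_nonneg_left this (hP z)
      linear_combination this
    have : t * ((1 - t) * D ^ 2) ≤ t * V := by linarith
    exact le_of_mul_le_mul_left this ht0
  have hDV : D ^ 2 ≤ V := by
    have hc : Tendsto (fun t : ℝ => (1 - t) * D ^ 2) (𝓝[>] 0) (𝓝 ((1 - 0) * D ^ 2)) :=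
      (Continuous.tendsto (by fun_prop) 0).mono_left nhdsWithin_le_nhds
    have := le_of_tendsto hc (b := V) (by
      filter_upwards [Ioc_mem_nhdsGT (zero_lt_one : (0 : ℝ) < 1)] with t ht using hV t ht.1 ht.2)
    simpa using this
  set S := ∑' z, P z * dist (v z) y
  have hVS : V ≤ 2 * D * S - D ^ 2 := by
    have hh : HasSum (fun z => 2 * D * (P z * dist (v z) y) - D ^ 2 * P z)
        (2 * D * S - D ^ 2 * 1) := ((hs y).hasSum.mul_left _).sub (hP1.mul_left _)
    rw [mul_one] at hh
    rw [← hh.tsum_eq]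
    refine (hsq y).tsum_le_tsum (fun z => ?_) hh.summable
    have h1 : |D - dist y (v z)| ≤ dist b (v z) := by
      rw [abs_sub_le_iff]
      constructor
      · have := dist_triangle b (v z) y
        rw [dist_comm (v z) y] at this
        linarith
      · have := dist_triangle y b (v z)
        rw [dist_comm y b] at this
        linarith
    have h2 := sq_le_sq' (by linarith [neg_abs_le (D - dist y (v z)), h1])
      ((le_abs_self _).trans h1)
    rw [dist_comm (v z) y]
    nlinarith [mul_le_mul_of_nonneg_left h2 (hP z)]
  have hS : 0 ≤ S := tsum_nonneg fun z => mul_nonneg (hP z) dist_nonneg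
  rcases (dist_nonneg : 0 ≤ D).eq_or_lt with h | h
  · exact h.symm.trans_le hS
  · have : D * D ≤ D * S := by nlinarith
    exact le_of_mul_le_mul_left this h

namespace WeightedGraph

variable {X : Type*} (G : WeightedGraph X)

lemma totalWeight_nonneg (x : X) : 0 ≤ G.totalWeight x := tsum_nonneg (G.μ_nonneg x)

lemma walkProb_nonneg (x z : X) : 0 ≤ G.walkProb x z :=
  div_nonneg (G.μ_nonneg x z) (G.totalWeight_nonneg x)

lemma totalWeight_mul_walkProb (x z : X) : G.totalWeight x * G.walkProb x z = G.μ x z := by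
  rcases eq_or_ne (G.totalWeight x) 0 with h | h
  · have : G.μ x z ≤ G.totalWeight x :=
      (G.μ_summable x).le_tsum z fun j _ => G.μ_nonneg x j
    rw [h, zero_mul]
    exact le_antisymm (G.μ_nonneg x z) (h ▸ this)
  · rw [walkProb, mul_div_cancel₀ _ h]

variable {G}

lemma IsHarmonicMap.isSubharmonic_dist [MeasurableSpace X] [DiscreteMeasurableSpace X]
    {Y : Type*} [MetricSpace Y] [MeasurableSpace Y] [BorelSpace Y] (hY : IsHadamardSpace Y)
    {u : X → Y} (hu : G.IsHarmonicMap u) (y : Y) :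
    G.IsSubharmonic fun x => dist (u x) y := by
  have hs (x : X) (y₀ : Y) : Summable fun z => G.walkProb x z * dist (u z) y₀ :=
    (hu.summable x y₀).congr fun z => mul_comm _ _
  refine ⟨fun x => ?_, fun x => ?_⟩
  · refine ((hs x y).mul_left (G.totalWeight x)).congr fun z => ?_
    rw [← mul_assoc, totalWeight_mul_walkProb]
  · have e : ∑' z, G.μ x z * dist (u z) y =
        G.totalWeight x * ∑' z, G.walkProb x z * dist (u z) y := by
      rw [← tsum_mul_left]
      refine tsum_congr fun z => ?_
      rw [← mul_assoc, totalWeight_mul_walkProb]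
    rw [e]
    rcases (G.totalWeight_nonneg x).eq_or_lt with h0 | h0
    · simp [← h0]
    refine mul_le_mul_of_nonneg_left ?_ h0.le
    have hP1 : HasSum (G.walkProb x) 1 := by
      have := (G.μ_summable x).hasSum.div_const (G.totalWeight x)
      rwa [← totalWeight, div_self h0.ne'] at this
    refine dist_le_tsum_of_minimizer hY (G.walkProb_nonneg x) hP1 (hs x) fun c hc => ?_
    have hb := hu.isBarycenter x (u x) c
    simp only [sub_self, integral_zero] at hb
    have hum : Measurable u := .of_discrete
    have hm : Measurable fun w => dist c w ^ 2 - dist (u x) w ^ 2 :=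
      (Continuous.measurable (by fun_prop))
    rw [integral_map hum.aemeasurable hm.aestronglyMeasurable] at hb
    rw [walkMeasure, integral_pointMassMeasure (G.walkProb_nonneg x)] at hb
    · exact hb
    · refine integrable_pointMassMeasure (G.walkProb_nonneg x)
        (hm.comp hum).aestronglyMeasurable (hc.abs.congr fun z => ?_)
      rw [abs_mul, abs_of_nonneg (G.walkProb_nonneg x z)]

end WeightedGraph

/-! ### The Caccioppoli inequality -/

/-- By homogeneity this is `1 - t ≤ c (1 - t ^ (p - 1))` for `t = a / b ∈ [0, 1]`; for `p < 2` it is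
Bernoulli's inequality. -/
lemma sub_mul_rpow_le {p a b : ℝ} (hp : 1 < p) (ha : 0 ≤ a) (hab : a ≤ b) :
    (b - a) * b ^ (p - 1) ≤ max 1 (p - 1)⁻¹ * b * (b ^ (p - 1) - a ^ (p - 1)) := by
  have hp' : 0 < p - 1 := by linarith
  rcases (ha.trans hab).eq_or_lt with h | hb
  · have : a = 0 := by linarith
    simp [← h, this, Real.zero_rpow hp'.ne']
  set t := a / b
  have ht0 : 0 ≤ t := by positivity
  have ht1 : t ≤ 1 := (div_le_one hb).2 hab
  have hat : a = t * b := by simp [t, hb.ne']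
  have key : 1 - t ≤ max 1 (p - 1)⁻¹ * (1 - t ^ (p - 1)) := by
    have hle : 0 ≤ 1 - t ^ (p - 1) := by
      linarith [Real.rpow_le_one ht0 ht1 hp'.le]
    rcases le_total 1 (p - 1) with h1 | h1
    · have h2 : t ^ (p - 1) ≤ t := by
        simpa using Real.rpow_le_rpow_of_exponent_ge_of_imp ht0 ht1 h1
          (fun _ h => absurd h (by linarith))
      calc 1 - t ≤ 1 * (1 - t ^ (p - 1)) := by linarith
        _ ≤ _ := by gcongr; exact le_max_left _ _
    · have h2 := rpow_one_add_le_one_add_mul_self (s := t - 1) (by linarith) hp'.le h1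
      rw [add_sub_cancel] at h2
      calc 1 - t = (p - 1)⁻¹ * ((p - 1) * (1 - t)) := by field_simp
        _ ≤ (p - 1)⁻¹ * (1 - t ^ (p - 1)) := by gcongr; linarith
        _ ≤ _ := by gcongr; exact le_max_right _ _
  rw [hat, Real.mul_rpow ht0 hb.le]
  have := mul_le_mul_of_nonneg_left key (by positivity : 0 ≤ b * b ^ (p - 1))
  linear_combination this

/-- The pointwise form of the Caccioppoli inequality: `a, b` are the values of a function and
`α, β` those of a cutoff at the two ends of an edge. -/
lemma caccioppoli_edge {p a b α β : ℝ} (hp : 1 < p) (ha : 0 ≤ a) (hb : 0 ≤ b) :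
    (α ^ 2 + β ^ 2) / 4 * ((b - a) * (b ^ (p - 1) - a ^ (p - 1))) ≤
      (b - a) * (β ^ 2 * b ^ (p - 1) - α ^ 2 * a ^ (p - 1)) +
        2 * max 1 (p - 1)⁻¹ * ((a ^ p + b ^ p) * (β - α) ^ 2) := by
  wlog hab : a ≤ b generalizing a b α β
  · have := this (α := β) (β := α) hb ha (by linarith)
    linear_combination this
  have hp' : 0 < p - 1 := by linarith
  have key := sub_mul_rpow_le hp ha hab
  have hc : 0 ≤ max 1 (p - 1)⁻¹ := le_max_of_le_left zero_le_one
  have hbp : b ^ p = b * b ^ (p - 1) := by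
    rw [← Real.rpow_one_add' hb (by linarith)]; congr 1; ring
  have hap : 0 ≤ a ^ p := by positivity
  have hA : 0 ≤ a ^ (p - 1) := by positivity
  have hAB : a ^ (p - 1) ≤ b ^ (p - 1) := Real.rpow_le_rpow ha hab hp'.le
  generalize max 1 (p - 1)⁻¹ = c at *
  generalize a ^ (p - 1) = A at *
  generalize b ^ (p - 1) = B at *
  generalize a ^ p = E at *
  rw [hbp]
  have hd : 0 ≤ b - a := by linarith
  have hB : 0 ≤ B := hA.trans hAB
  have hW : 0 ≤ (b - a) * (B - A) := mul_nonneg hd (by linarith)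
  have hF : 0 ≤ c * (b * B) := by positivity
  have hX : ((b - a) * B) ^ 2 ≤ (c * (b * B)) * ((b - a) * (B - A)) := by
    have := mul_le_mul_of_nonneg_left key (mul_nonneg hd hB)
    linear_combination this
  generalize hWd : (b - a) * (B - A) = W at *
  generalize hFd : c * (b * B) = F at *
  have hX0 : 0 ≤ (b - a) * B := mul_nonneg hd hB
  have hyoung : (b - a) * B * (|β - α| * |α + β|) ≤
      (α + β) ^ 2 / 8 * W + 2 * F * (β - α) ^ 2 := by
    have h1 : ((b - a) * B * (|β - α| * |α + β|)) ^ 2 ≤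
        ((α + β) ^ 2 / 8 * W + 2 * F * (β - α) ^ 2) ^ 2 := by
      have h2 := mul_le_mul_of_nonneg_right hX
        (by positivity : 0 ≤ (β - α) ^ 2 * (α + β) ^ 2)
      rw [mul_pow, mul_pow |β - α|, sq_abs, sq_abs]
      nlinarith [sq_nonneg ((α + β) ^ 2 / 8 * W - 2 * F * (β - α) ^ 2)]
    exact le_of_sq_le_sq h1 (by positivity)
  have hcross : -((b - a) * B * (|β - α| * |α + β|)) ≤
      (b - a) * ((A + B) / 2) * ((β - α) * (α + β)) := by
    rw [← abs_mul]
    have h1 : |(b - a) * ((A + B) / 2) * ((β - α) * (α + β))| ≤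
        (b - a) * B * |(β - α) * (α + β)| := by
      rw [abs_mul, abs_of_nonneg (by positivity)]
      gcongr
      linarith
    linarith [neg_abs_le ((b - a) * ((A + B) / 2) * ((β - α) * (α + β)))]
  have hs : (α + β) ^ 2 / 8 * W ≤ (α ^ 2 + β ^ 2) / 4 * W := by
    refine mul_le_mul_of_nonneg_right ?_ hW
    nlinarith [sq_nonneg (α - β)]
  have hE : 0 ≤ c * (E * (β - α) ^ 2) := by positivity
  have e1 : (b - a) * (β ^ 2 * B - α ^ 2 * A) =
      (α ^ 2 + β ^ 2) / 2 * W + (b - a) * ((A + B) / 2) * ((β - α) * (α + β)) := by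
    rw [← hWd]; ring
  have e2 : 2 * c * ((E + b * B) * (β - α) ^ 2) =
      2 * (c * (E * (β - α) ^ 2)) + 2 * F * (β - α) ^ 2 := by
    rw [← hFd]; ring
  rw [e1, e2]
  linarith

namespace WeightedGraph

variable {X : Type*} {G : WeightedGraph X}

/-- Testing subharmonicity against `φ ≥ 0` and summing by parts. -/
lemma IsSubharmonic.tsum_grad_mul_grad_le {f φ : X → ℝ} (hf : G.IsSubharmonic f)
    (hφ : ∀ x, 0 ≤ φ x)
    (hs : Summable fun z : X × X => G.μ z.1 z.2 * (f z.2 - f z.1) * φ z.1) :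
    Summable (fun z : X × X => G.μ z.1 z.2 * ((f z.2 - f z.1) * (φ z.2 - φ z.1))) ∧
      ∑' z : X × X, G.μ z.1 z.2 * ((f z.2 - f z.1) * (φ z.2 - φ z.1)) ≤ 0 := by
  have h0 : 0 ≤ ∑' z : X × X, G.μ z.1 z.2 * (f z.2 - f z.1) * φ z.1 := by
    rw [hs.tsum_prod]
    refine tsum_nonneg fun x => ?_
    dsimp only
    rw [tsum_mul_right]
    refine mul_nonneg ?_ (hφ x)
    simp only [mul_sub]
    rw [(hf.summable x).tsum_sub ((G.μ_summable x).mul_right _), tsum_mul_right]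
    exact sub_nonneg.2 (hf.le_tsum x)
  have hs' := (Equiv.prodComm X X).summable_iff.2 hs
  have ht := (Equiv.prodComm X X).tsum_eq fun z : X × X => G.μ z.1 z.2 * (f z.2 - f z.1) * φ z.1
  have hh := (hs.hasSum.add hs'.hasSum).neg
  have e : (fun z : X × X => G.μ z.1 z.2 * ((f z.2 - f z.1) * (φ z.2 - φ z.1))) =
      fun z => -(G.μ z.1 z.2 * (f z.2 - f z.1) * φ z.1 +
        ((fun z : X × X => G.μ z.1 z.2 * (f z.2 - f z.1) * φ z.1) ∘ Equiv.prodComm X X) z) := by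
    ext z
    simp only [Function.comp, Equiv.prodComm_apply, Prod.fst_swap, Prod.snd_swap]
    rw [G.μ_symm z.2 z.1]
    ring
  rw [e]
  refine ⟨hh.summable, ?_⟩
  rw [hh.tsum_eq]
  have : ∑' z, ((fun z : X × X => G.μ z.1 z.2 * (f z.2 - f z.1) * φ z.1) ∘
    Equiv.prodComm X X) z = _ := ht
  linarith

/-- The Caccioppoli inequality, for a single edge on the left-hand side. The summability hypothesis
makes all the double sums in the summation by parts converge absolutely. -/
lemma IsSubharmonic.caccioppoli {f η : X → ℝ} {p : ℝ} (hp : 1 < p) (hf : G.IsSubharmonic f)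
    (hf0 : ∀ x, 0 ≤ f x)
    (hs : Summable fun z : X × X => G.μ z.1 z.2 * (f z.1 ^ p + f z.2 ^ p) * η z.1 ^ 2)
    (x y : X) :
    G.μ x y * ((η x ^ 2 + η y ^ 2) / 4 * ((f y - f x) * (f y ^ (p - 1) - f x ^ (p - 1)))) ≤
      4 * max 1 (p - 1)⁻¹ * ∑' x, f x ^ p * ∑' y, G.μ x y * (η y - η x) ^ 2 := by
  set φ : X → ℝ := fun x => η x ^ 2 * f x ^ (p - 1)
  have hφ : ∀ x, 0 ≤ φ x := fun x => mul_nonneg (sq_nonneg _) (Real.rpow_nonneg (hf0 x) _)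
  have hpow (a : ℝ) (ha : 0 ≤ a) : a ^ p = a * a ^ (p - 1) := by
    rw [← Real.rpow_one_add' ha (by linarith)]; congr 1; ring
  have htest : Summable fun z : X × X => G.μ z.1 z.2 * (f z.2 - f z.1) * φ z.1 := by
    refine Summable.of_norm_bounded hs fun z => ?_
    have ha := hf0 z.1
    have hb := hf0 z.2
    have hab : |f z.2 - f z.1| * f z.1 ^ (p - 1) ≤ f z.1 ^ p + f z.2 ^ p := by
      rw [hpow _ ha, hpow _ hb]
      have h1 : 0 ≤ f z.1 ^ (p - 1) := by positivity
      have h2 : 0 ≤ f z.2 ^ (p - 1) := by positivity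
      rcases le_total (f z.1) (f z.2) with h | h
      · rw [abs_of_nonneg (by linarith)]
        have h3 : f z.1 ^ (p - 1) ≤ f z.2 ^ (p - 1) := Real.rpow_le_rpow ha h (by linarith)
        nlinarith [mul_le_mul_of_nonneg_left h3 hb, mul_nonneg ha h1]
      · rw [abs_of_nonpos (by linarith)]
        nlinarith [mul_nonneg hb h1, mul_nonneg hb h2]
    rw [Real.norm_eq_abs, abs_mul, abs_mul, abs_of_nonneg (G.μ_nonneg _ _), abs_of_nonneg (hφ _)]
    have := mul_le_mul_of_nonneg_left hab
      (mul_nonneg (G.μ_nonneg z.1 z.2) (sq_nonneg (η z.1)))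
    linear_combination this
  obtain ⟨hg, hg0⟩ := hf.tsum_grad_mul_grad_le hφ htest
  have hs' := (Equiv.prodComm X X).summable_iff.2 hs
  -- The energy density of the cutoff, weighted by `f ^ p` at the first vertex.
  set e : X × X → ℝ := fun z => f z.1 ^ p * (G.μ z.1 z.2 * (η z.2 - η z.1) ^ 2)
  have he0 : ∀ z, 0 ≤ e z := fun z => mul_nonneg (Real.rpow_nonneg (hf0 _) _)
    (mul_nonneg (G.μ_nonneg _ _) (sq_nonneg _))
  have he : Summable e := by
    refine Summable.of_nonneg_of_le he0 (fun z => ?_) ((hs.add hs').mul_left 2)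
    simp only [Function.comp, Equiv.prodComm_apply, Prod.fst_swap, Prod.snd_swap, e]
    rw [G.μ_symm z.2 z.1]
    have h1 : 0 ≤ f z.1 ^ p := Real.rpow_nonneg (hf0 _) _
    have h2 : 0 ≤ f z.2 ^ p := Real.rpow_nonneg (hf0 _) _
    have h3 : (η z.2 - η z.1) ^ 2 ≤ 2 * (η z.1 ^ 2 + η z.2 ^ 2) := by
      nlinarith [sq_nonneg (η z.2 + η z.1)]
    calc f z.1 ^ p * (G.μ z.1 z.2 * (η z.2 - η z.1) ^ 2)
        ≤ (f z.1 ^ p + f z.2 ^ p) * (G.μ z.1 z.2 * (2 * (η z.1 ^ 2 + η z.2 ^ 2))) := by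
          have := G.μ_nonneg z.1 z.2
          gcongr
          linarith
      _ = _ := by ring
  have he' := (Equiv.prodComm X X).summable_iff.2 he
  have het := (Equiv.prodComm X X).tsum_eq e
  have hprod : ∑' z, e z = ∑' x, f x ^ p * ∑' y, G.μ x y * (η y - η x) ^ 2 := by
    rw [he.tsum_prod]
    simp only [e, tsum_mul_left]
  rw [← hprod]
  set c := max 1 (p - 1)⁻¹
  have hR := hg.hasSum.add ((he.hasSum.add he'.hasSum).mul_left (2 * c))
  set L : X × X → ℝ := fun z => G.μ z.1 z.2 * ((η z.1 ^ 2 + η z.2 ^ 2) / 4 *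
    ((f z.2 - f z.1) * (f z.2 ^ (p - 1) - f z.1 ^ (p - 1))))
  have hL0 : ∀ z, 0 ≤ L z := by
    intro z
    refine mul_nonneg (G.μ_nonneg _ _) (mul_nonneg (by positivity) ?_)
    rcases le_total (f z.1) (f z.2) with h | h
    · have := Real.rpow_le_rpow (hf0 z.1) h (by linarith : 0 ≤ p - 1)
      exact mul_nonneg (by linarith) (by linarith)
    · have := Real.rpow_le_rpow (hf0 z.2) h (by linarith : 0 ≤ p - 1)
      exact mul_nonneg_of_nonpos_of_nonpos (by linarith) (by linarith)
  have hLR : ∀ z, L z ≤ G.μ z.1 z.2 * ((f z.2 - f z.1) * (φ z.2 - φ z.1)) +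
      2 * c * (e z + (e ∘ Equiv.prodComm X X) z) := by
    intro z
    simp only [Function.comp, Equiv.prodComm_apply, e, φ, L, Prod.fst_swap, Prod.snd_swap]
    rw [G.μ_symm z.2 z.1]
    have := mul_le_mul_of_nonneg_left
      (caccioppoli_edge (α := η z.1) (β := η z.2) hp (hf0 z.1) (hf0 z.2)) (G.μ_nonneg z.1 z.2)
    linear_combination this
  have h1 : L (x, y) ≤ _ := (hLR (x, y)).trans
    (le_hasSum hR (x, y) fun z _ => (hL0 z).trans (hLR z))
  have h2 : ∑' z, (e ∘ Equiv.prodComm X X) z = ∑' z, e z := het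
  rw [h2] at h1
  simp only [L] at h1
  linarith

/-! ### Karp's theorem for subharmonic functions -/

lemma exists_jump_bound {ρ : X → X → ℝ} (h : G.jumpSize ρ < ∞) :
    ∃ s : ℝ, ∀ x y, G.Adj x y → ρ x y ≤ s := by
  refine ⟨(G.jumpSize ρ).toReal, fun x y hxy => ?_⟩
  rw [← ENNReal.ofReal_le_iff_le_toReal h.ne]
  exact le_iSup_of_le x (le_iSup_of_le y (le_iSup_of_le hxy le_rfl))

/-- On a ball, the degree bound makes the energy of a locally summable function finite. -/
lemma summable_energy_on_ball {ρ : X → X → ℝ} (hρ : IsPseudoMetric ρ) (hc : G.IsCompatible ρ)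
    (o : X) {F : X → ℝ} (hF0 : ∀ x, 0 ≤ F x)
    (hF : ∀ R : ℝ, Summable fun x => {x | ρ x o ≤ R}.indicator (fun x => G.m x * F x) x)
    (R : ℝ) {η : X → ℝ} (hη : ∀ x, |η x| ≤ 1) (hηR : ∀ x, R < ρ x o → η x = 0) :
    Summable fun z : X × X => G.μ z.1 z.2 * (F z.1 + F z.2) * η z.1 ^ 2 := by
  obtain ⟨s, hs⟩ := exists_jump_bound hc.jumpSize_lt_top
  -- The sum over `y` of the energy at `x` is `Deg x * m x * F x`.
  have main (R : ℝ) : Summable fun z : X × X =>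
      {x | ρ x o ≤ R}.indicator F z.1 * G.μ z.1 z.2 := by
    have hJ0 (x : X) : 0 ≤ {x | ρ x o ≤ R}.indicator F x :=
      Set.indicator_nonneg (fun x _ => hF0 x) x
    have hprod {J : X → ℝ} (hJ : ∀ x, 0 ≤ J x) (h : Summable fun x => J x * G.totalWeight x) :
        Summable fun z : X × X => J z.1 * G.μ z.1 z.2 := by
      refine (summable_prod_of_nonneg fun z => mul_nonneg (hJ _) (G.μ_nonneg _ _)).2
        ⟨fun x => ?_, ?_⟩
      · exact (G.μ_summable x).mul_left (J x)
      · simpa only [tsum_mul_left, totalWeight] using h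
    refine hprod hJ0 ?_
    obtain ⟨C, hC⟩ := hc.deg_bounded o (max R 0) (le_max_right _ _)
    refine Summable.of_nonneg_of_le (fun x => mul_nonneg (hJ0 x) (G.totalWeight_nonneg x))
      (fun x => ?_) ((hF R).mul_left C)
    by_cases hx : ρ x o ≤ R
    · have hd := hC x (hx.trans (le_max_left _ _))
      rw [Deg, div_le_iff₀ (G.m_pos x)] at hd
      have := mul_le_mul_of_nonneg_right hd (hF0 x)
      simp only [Set.indicator, Set.mem_ofPred_eq, hx, if_true]
      linear_combination this
    · simp [Set.indicator, hx]
  have h2 := (Equiv.prodComm X X).summable_iff.2 (main (R + s))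
  refine Summable.of_nonneg_of_le (fun z => mul_nonneg (mul_nonneg (G.μ_nonneg _ _)
    (add_nonneg (hF0 _) (hF0 _))) (sq_nonneg _)) (fun z => ?_) ((main R).add h2)
  have hn1 : 0 ≤ {x | ρ x o ≤ R}.indicator F z.1 := Set.indicator_nonneg (fun x _ => hF0 x) _
  have hn2 : 0 ≤ {x | ρ x o ≤ R + s}.indicator F z.2 :=
    Set.indicator_nonneg (fun x _ => hF0 x) _
  have hμ := G.μ_nonneg z.1 z.2
  simp only [Function.comp, Equiv.prodComm_apply, Prod.fst_swap, Prod.snd_swap]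
  rw [G.μ_symm z.2 z.1]
  by_cases hx : ρ z.1 o ≤ R
  · rcases hμ.eq_or_lt with h0 | h0
    · simp [← h0]
    · have hz : ρ z.2 o ≤ R + s := by
        have h1 := hs _ _ h0
        have h2 := hρ.triangle z.2 z.1 o
        rw [hρ.symm z.2 z.1] at h2
        linarith
      simp only [Set.indicator, Set.mem_ofPred_eq, hx, hz, if_true]
      have h1 : η z.1 ^ 2 ≤ 1 := (sq_le_one_iff_abs_le_one _).2 (hη _)
      have := mul_le_mul_of_nonneg_left h1 (mul_nonneg hμ (add_nonneg (hF0 z.1) (hF0 z.2)))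
      linear_combination this
  · rw [hηR _ (not_le.1 hx)]
    simp only [ne_eq, OfNat.ofNat_ne_zero, not_false_eq_true, zero_pow, mul_zero]
    positivity

/-- The cutoff function that is `1` on the ball of radius `r` around `o`, `0` outside the ball of
radius `2 r`, and affine in the distance in between. -/
noncomputable def cutoff (ρ : X → X → ℝ) (o : X) (r : ℝ) (x : X) : ℝ :=
  max 0 (min 1 (2 - ρ x o / r))

lemma cutoff_nonneg (ρ : X → X → ℝ) (o : X) (r : ℝ) (x : X) : 0 ≤ cutoff ρ o r x :=
  le_max_left _ _

lemma cutoff_le_one (ρ : X → X → ℝ) (o : X) (r : ℝ) (x : X) : cutoff ρ o r x ≤ 1 :=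
  max_le zero_le_one (min_le_left _ _)

lemma cutoff_eq_one {ρ : X → X → ℝ} {o : X} {r : ℝ} (hr : 0 < r) {x : X} (hx : ρ x o ≤ r) :
    cutoff ρ o r x = 1 := by
  have : ρ x o / r ≤ 1 := (div_le_one hr).2 hx
  rw [cutoff, min_eq_left (by linarith), max_eq_right zero_le_one]

lemma cutoff_eq_zero {ρ : X → X → ℝ} {o : X} {r : ℝ} (hr : 0 < r) {x : X} (hx : 2 * r ≤ ρ x o) :
    cutoff ρ o r x = 0 := by
  have : 2 ≤ ρ x o / r := (le_div_iff₀ hr).2 hx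
  exact max_eq_left ((min_le_right _ _).trans (by linarith))

lemma abs_cutoff_sub_le {ρ : X → X → ℝ} (hρ : IsPseudoMetric ρ) (o : X) {r : ℝ} (hr : 0 < r)
    (x y : X) : |cutoff ρ o r y - cutoff ρ o r x| ≤ ρ x y / r := by
  have h1 : |cutoff ρ o r y - cutoff ρ o r x| ≤ |(2 - ρ y o / r) - (2 - ρ x o / r)| := by
    refine (abs_max_sub_max_le_max _ _ _ _).trans ?_
    rw [sub_self, abs_zero, max_eq_right (abs_nonneg _)]
    refine (abs_min_sub_min_le_max _ _ _ _).trans ?_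
    rw [sub_self, abs_zero, max_eq_right (abs_nonneg _)]
  refine h1.trans ?_
  have e : (2 - ρ y o / r) - (2 - ρ x o / r) = (ρ x o - ρ y o) / r := by ring
  rw [e, abs_div, abs_of_pos hr]
  gcongr
  rw [abs_sub_le_iff]
  have h2 := hρ.triangle x y o
  have h3 := hρ.triangle y x o
  rw [hρ.symm y x] at h3
  constructor <;> linarith

lemma tsum_grad_cutoff_sq_le {ρ : X → X → ℝ} (hρ : G.IsIntrinsic ρ) (o : X) {r : ℝ} (hr : 0 < r)
    (x : X) : ∑' y, G.μ x y * (cutoff ρ o r y - cutoff ρ o r x) ^ 2 ≤ G.m x / r ^ 2 := by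
  have hb (y : X) : G.μ x y * (cutoff ρ o r y - cutoff ρ o r x) ^ 2 ≤
      G.μ x y * ρ x y ^ 2 / r ^ 2 := by
    rw [mul_div_assoc, ← div_pow, ← sq_abs (_ - _)]
    have := abs_cutoff_sub_le hρ.isPseudoMetric o hr x y
    have := G.μ_nonneg x y
    gcongr
  have hsum := (hρ.summable x).div_const (r ^ 2)
  calc _ ≤ ∑' y, G.μ x y * ρ x y ^ 2 / r ^ 2 :=
        (Summable.of_nonneg_of_le (fun y => mul_nonneg (G.μ_nonneg _ _) (sq_nonneg _)) hb
          hsum).tsum_le_tsum hb hsum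
    _ = (∑' y, G.μ x y * ρ x y ^ 2) / r ^ 2 := tsum_div_const
    _ ≤ _ := by gcongr; exact hρ.tsum_le x

/-- For radii exceeding the jump size, the cutoff has no energy at distance more than `3 r`, and
elsewhere `ρ₁ ≤ 3 r`. -/
lemma tsum_grad_cutoff_sq_le_rhoOne {ρ : X → X → ℝ} (hρ : G.IsIntrinsic ρ) {s : ℝ}
    (hs : ∀ x y, G.Adj x y → ρ x y ≤ s) (o : X) {r : ℝ} (hr : 1 ≤ r) (hsr : s ≤ r) (x : X) :
    ∑' y, G.μ x y * (cutoff ρ o r y - cutoff ρ o r x) ^ 2 ≤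
      9 * (G.m x * (rhoOne ρ o x ^ 2)⁻¹) := by
  have hr0 : 0 < r := by linarith
  have hm := G.m_pos x
  have hρ1 : 1 ≤ rhoOne ρ o x := le_max_left _ _
  by_cases hx : ρ x o ≤ 3 * r
  · refine (tsum_grad_cutoff_sq_le hρ o hr0 x).trans ?_
    have h1 : rhoOne ρ o x ≤ 3 * r := max_le (by linarith) hx
    have h2 : (r ^ 2)⁻¹ ≤ 9 * (rhoOne ρ o x ^ 2)⁻¹ := by
      rw [← div_eq_mul_inv, inv_eq_one_div, div_le_div_iff₀ (by positivity) (by positivity)]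
      nlinarith
    rw [div_eq_mul_inv]
    nlinarith
  · have h0 : ∀ y, G.μ x y * (cutoff ρ o r y - cutoff ρ o r x) ^ 2 = 0 := by
      intro y
      rcases (G.μ_nonneg x y).eq_or_lt with h | h
      · simp [← h]
      · have h1 := hs x y h
        have h2 := hρ.isPseudoMetric.triangle x y o
        rw [cutoff_eq_zero hr0 (by linarith : 2 * r ≤ ρ x o),
          cutoff_eq_zero hr0 (by linarith : 2 * r ≤ ρ y o)]
        simp
    simp only [h0, tsum_zero]
    positivity

/-- Karp's theorem for nonnegative subharmonic functions: the right-hand side of the Caccioppoli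
inequality for `cutoff ρ o r` tends to zero as `r → ∞` by dominated convergence. -/
theorem IsSubharmonic.eq_of_summable {ρ : X → X → ℝ} (hG : G.Connected) (hρi : G.IsIntrinsic ρ)
    (hρc : G.IsCompatible ρ) (o : X) {f : X → ℝ} {p : ℝ} (hp : 1 < p) (hf : G.IsSubharmonic f)
    (hf0 : ∀ x, 0 ≤ f x)
    (hs : Summable fun x => G.m x * (rhoOne ρ o x ^ 2)⁻¹ * f x ^ p) (x y : X) :
    f x = f y := by
  have hadj : ∀ x y, G.Adj x y → f x = f y := by
    intro x y hxy
    obtain ⟨s, hjump⟩ := exists_jump_bound hρc.jumpSize_lt_top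
    have hF0 : ∀ x, 0 ≤ f x ^ p := fun x => Real.rpow_nonneg (hf0 x) _
    have hρ1 : ∀ x, 1 ≤ rhoOne ρ o x := fun x => le_max_left _ _
    have hloc (R : ℝ) :
        Summable fun x => {x | ρ x o ≤ R}.indicator (fun x => G.m x * f x ^ p) x := by
      refine Summable.of_nonneg_of_le (fun x => Set.indicator_nonneg
        (fun x _ => mul_nonneg (G.m_pos x).le (hF0 x)) _) (fun x => ?_)
        (hs.mul_left (max 1 R ^ 2))
      have h1 := hρ1 x
      have hm := (G.m_pos x).le
      have hF := hF0 x
      by_cases hx : ρ x o ≤ R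
      · have h2 : rhoOne ρ o x ≤ max 1 R := max_le_max le_rfl hx
        simp only [Set.indicator, Set.mem_ofPred_eq, hx, if_true]
        have h3 : 1 ≤ max 1 R ^ 2 * (rhoOne ρ o x ^ 2)⁻¹ := by
          rw [← div_eq_mul_inv, one_le_div (by positivity)]
          gcongr
        have := mul_le_mul_of_nonneg_right h3 (mul_nonneg hm hF)
        linear_combination this
      · simp only [Set.indicator, Set.mem_ofPred_eq, hx, if_false]
        positivity
    set E : ℝ → X → ℝ := fun r x =>
      f x ^ p * ∑' y, G.μ x y * (cutoff ρ o r y - cutoff ρ o r x) ^ 2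
    have hE0 (r : ℝ) (x : X) : 0 ≤ E r x := mul_nonneg (hF0 x)
      (tsum_nonneg fun y => mul_nonneg (G.μ_nonneg _ _) (sq_nonneg _))
    have hlim : Tendsto (fun r => ∑' x, E r x) atTop (𝓝 (∑' _ : X, 0)) := by
      refine tendsto_tsum_of_dominated_convergence (hs.mul_left 9) (fun x => ?_) ?_
      · have h1 : Tendsto (fun r : ℝ => f x ^ p * (G.m x / r ^ 2)) atTop (𝓝 (f x ^ p * 0)) :=
          (tendsto_const_nhds.div_atTop (tendsto_pow_atTop two_ne_zero)).const_mul _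
        rw [mul_zero] at h1
        refine squeeze_zero' (.of_forall fun r => hE0 r x) ?_ h1
        filter_upwards [eventually_gt_atTop 0] with r hr
        exact mul_le_mul_of_nonneg_left (tsum_grad_cutoff_sq_le hρi o hr x) (hF0 x)
      · filter_upwards [eventually_ge_atTop 1, eventually_ge_atTop s] with r hr hsr x
        rw [Real.norm_of_nonneg (hE0 r x)]
        have := mul_le_mul_of_nonneg_left
          (tsum_grad_cutoff_sq_le_rhoOne hρi hjump o hr hsr x) (hF0 x)
        linear_combination this
    rw [tsum_zero] at hlim
    have hle : G.μ x y * (1 / 2 * ((f y - f x) * (f y ^ (p - 1) - f x ^ (p - 1)))) ≤ 0 := by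
      have hlim' := hlim.const_mul (4 * max 1 (p - 1)⁻¹)
      rw [mul_zero] at hlim'
      refine ge_of_tendsto hlim' ?_
      filter_upwards [eventually_gt_atTop 0, eventually_ge_atTop (ρ x o),
        eventually_ge_atTop (ρ y o)] with r hr hx hy
      have := hf.caccioppoli (η := cutoff ρ o r) hp hf0
        (summable_energy_on_ball hρi.isPseudoMetric hρc o hF0 hloc (2 * r)
          (fun x => abs_le.2 ⟨by linarith [cutoff_nonneg ρ o r x], cutoff_le_one ρ o r x⟩)
          (fun x hx => cutoff_eq_zero hr hx.le)) x y
      rw [cutoff_eq_one hr hx, cutoff_eq_one hr hy] at this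
      norm_num at this ⊢
      exact this
    have hμ : 0 < G.μ x y := hxy
    have hW : (f y - f x) * (f y ^ (p - 1) - f x ^ (p - 1)) ≤ 0 := by
      by_contra! h
      have : 0 < G.μ x y * (1 / 2 * ((f y - f x) * (f y ^ (p - 1) - f x ^ (p - 1)))) := by
        positivity
      linarith
    rcases lt_trichotomy (f x) (f y) with h | h | h
    · have := Real.rpow_lt_rpow (hf0 x) h (by linarith : 0 < p - 1)
      exact absurd (mul_pos (sub_pos.2 h) (sub_pos.2 this)) hW.not_gt
    · exact h
    · have := Real.rpow_lt_rpow (hf0 y) h (by linarith : 0 < p - 1)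
      exact absurd (mul_pos_of_neg_of_neg (sub_neg.2 h) (sub_neg.2 this)) hW.not_gt
  induction hG x y with
  | refl => rfl
  | tail _ h ih => exact ih.trans (hadj _ _ h)

end WeightedGraph

/-! ### Harmonic maps -/

theorem theorem1p8 {X : Type*} [Countable X] [MeasurableSpace X] [DiscreteMeasurableSpace X]
    (G : WeightedGraph X) (hG : G.Connected)
    (ρ : X → X → ℝ) (hρi : G.IsIntrinsic ρ) (hρc : G.IsCompatible ρ) (o : X)
    {Y : Type*} [MetricSpace Y] [MeasurableSpace Y] [BorelSpace Y] (hY : IsHadamardSpace Y)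
    (u : X → Y) (hu : G.IsHarmonicMap u)
    (p : ℝ≥0∞) (hp1 : 1 < p) (hp : p < ∞) (y : Y)
    (hLp : MemLp (fun x => dist (u x) y) p
      (pointMassMeasure fun x => G.m x * (rhoOne ρ o x ^ 2)⁻¹)) :
    Bornology.IsBounded (Set.range u) ∧
      ((pointMassMeasure (fun x => G.m x * (rhoOne ρ o x ^ 2)⁻¹) Set.univ = ∞ ∨
          y ∈ Set.range u) →
        ∃ c : Y, ∀ x, u x = c) := by
  have hp0 : p ≠ 0 := (zero_lt_one.trans hp1).ne'
  have hpr : 1 < p.toReal := by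
    rwa [← ENNReal.toReal_one, ENNReal.toReal_lt_toReal ENNReal.one_ne_top hp.ne]
  have hconst (x : X) : dist (u x) y = dist (u o) y :=
    (hu.isSubharmonic_dist hY y).eq_of_summable hG hρi hρc o hpr (fun _ => dist_nonneg)
      (summable_rpow_of_memLp_pointMassMeasure
        (fun x => mul_nonneg (G.m_pos x).le (by positivity)) (fun _ => dist_nonneg) hp0 hp.ne hLp)
      x o
  refine ⟨?_, fun h => ⟨y, fun x => ?_⟩⟩
  · refine Metric.isBounded_closedBall.subset (t := Metric.closedBall y (dist (u o) y)) ?_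
    rintro _ ⟨x, rfl⟩
    exact (hconst x).le
  · rw [← dist_eq_zero, hconst x]
    rcases h with h | ⟨x₀, h⟩
    · simp only [hconst] at hLp
      rw [memLp_const_iff hp0 hp.ne] at hLp
      exact hLp.resolve_right h.not_lt
    · rw [← hconst x₀, h, dist_self]
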